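/- Let $d\ge 24$ and let $C$ be a positive semidefinite operator on $\mathbb{C}^d\otimes\mathbb{C}^d$ of rank $r$ all of whose nonzero eigenvalues are equal, i.e. whose eigenvalues, with multiplicity and in decreasing order, are $\lambda(C)=(\lambda_1,\dots,\lambda_{d^2})=(\lambda,\dots,\lambda,0,\dots,0)$ with $r$ entries $\lambda$. Notation. View an operator $X$ on $\mathbb{C}^d\otimes\mathbb{C}^d$ as a $d\times d$ block matrix $[X_{ij}]$ with $d\times d$ blocks; its partial traces are the $d\times d$ matrices $\mathrm{tr}_1[X]=\sum_i X_{ii}$ and $\mathrm{tr}_2[X]=(\mathrm{tr}\,X_{ij})_{ij}$. For self-adjoint $X$ let $\lambda^{(1,2)}(X)\in\mathbb{R}^{2d}$ be the vector of eigenvalues (with multiplicity) of $\mathrm{tr}_1[X]\oplus\mathrm{tr}_2[X]$. For $\pi\in S_{d^2}$ let $\Lambda_\pi$ be the diagonal matrix with $(\Lambda_\pi)_{kk}=\lambda_{\pi(k)}$, $1\le k\le d^2$. For $x,y\in\mathbb{R}^n$ write $x\preceq y$ ($x$ is majorized by $y$) if for every $1\le k\le n$ the sum of the $k$ largest entries of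 $x$ is at most the sum of the $k$ largest entries of $y$, and $\sum_i x_i=\sum_i y_i$. Then there exists a permutation $\pi\in S_{d^2}$ such that $$\lambda^{(1,2)}(UCU^*)\preceq\lambda^{(1,2)}(\Lambda_\pi)\quad\text{for every unitary } U \text{ on } \mathbb{C}^d\otimes\mathbb{C}^d$$ if and only if $r\le 3$ or $r\ge d^2-3$. -/

import Mathlib

open scoped Matrix ComplexOrder

namespace BipartiteSpectra

/-- First partial trace of a `d₁ × d₁` block matrix `[Cᵢⱼ]` with blocks of size `d₂ × d₂`,
that is, of an operator on `ℂ^d₁ ⊗ ℂ^d₂`: the sum of the diagonal blocks. -/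
def trOne {d₁ d₂ : ℕ} (C : Matrix (Fin d₁ × Fin d₂) (Fin d₁ × Fin d₂) ℂ) :
    Matrix (Fin d₂) (Fin d₂) ℂ :=
  Matrix.of fun s t => ∑ i, C (i, s) (i, t)

/-- Second partial trace: the matrix of the traces of the blocks. -/
def trTwo {d₁ d₂ : ℕ} (C : Matrix (Fin d₁ × Fin d₂) (Fin d₁ × Fin d₂) ℂ) :
    Matrix (Fin d₁) (Fin d₁) ℂ :=
  Matrix.of fun i j => ∑ s, C (i, s) (j, s)

theorem isHermitian_trOne {d₁ d₂ : ℕ} {C : Matrix (Fin d₁ × Fin d₂) (Fin d₁ × Fin d₂) ℂ}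
    (hC : C.IsHermitian) : (trOne C).IsHermitian := by
  ext s t
  simp only [Matrix.conjTranspose_apply, trOne, Matrix.of_apply, star_sum]
  exact Finset.sum_congr rfl fun i _ => hC.apply _ _

theorem isHermitian_trTwo {d₁ d₂ : ℕ} {C : Matrix (Fin d₁ × Fin d₂) (Fin d₁ × Fin d₂) ℂ}
    (hC : C.IsHermitian) : (trTwo C).IsHermitian := by
  ext i j
  simp only [Matrix.conjTranspose_apply, trTwo, Matrix.of_apply, star_sum]
  exact Finset.sum_congr rfl fun s _ => hC.apply _ _

/-- The eigenvalues, with multiplicity and in decreasing order, of a Hermitian matrix of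
size `N`. -/
noncomputable def eigs {n : Type*} [Fintype n] [DecidableEq n] {N : ℕ} {A : Matrix n n ℂ}
    (hA : A.IsHermitian) (hN : Fintype.card n = N) : Fin N → ℝ :=
  fun k => hA.eigenvalues₀ (Fin.cast hN.symm k)

/-- The spectrum `λ(C) ∈ ℝ^(d₁d₂)` of a Hermitian operator on `ℂ^d₁ ⊗ ℂ^d₂`. -/
noncomputable def spec {d₁ d₂ : ℕ} {C : Matrix (Fin d₁ × Fin d₂) (Fin d₁ × Fin d₂) ℂ}
    (hC : C.IsHermitian) : Fin (d₁ * d₂) → ℝ :=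
  eigs hC (by simp)

/-- The vector `λ(tr₁ C) ⊕ λ(tr₂ C) ∈ ℝ^(d₂ + d₁)`, which lists the eigenvalues of
`tr₁ C ⊕ tr₂ C`. -/
noncomputable def jointSpec {d₁ d₂ : ℕ} {C : Matrix (Fin d₁ × Fin d₂) (Fin d₁ × Fin d₂) ℂ}
    (hC : C.IsHermitian) : Fin (d₂ + d₁) → ℝ :=
  Fin.append (eigs (isHermitian_trOne hC) (Fintype.card_fin d₂))
    (eigs (isHermitian_trTwo hC) (Fintype.card_fin d₁))

/-- The diagonal matrix `Λ_π` with diagonal entries `λ_{π(1)}, …, λ_{π(d₁d₂)}`, where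
`λ = λ(C)`; the position `(i, s)` (entry `s` of block `i`) is the `((i - 1) d₂ + s)`-th one when
counted from `1`, and `finProdFinEquiv (i, s)` is `i * d₂ + s` when counted from `0`. -/
noncomputable def permDiag {d₁ d₂ : ℕ} {C : Matrix (Fin d₁ × Fin d₂) (Fin d₁ × Fin d₂) ℂ}
    (hC : C.IsHermitian) (π : Equiv.Perm (Fin (d₁ * d₂))) :
    Matrix (Fin d₁ × Fin d₂) (Fin d₁ × Fin d₂) ℂ :=
  Matrix.diagonal fun p => ((spec hC (π (finProdFinEquiv p)) : ℝ) : ℂ)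

theorem isHermitian_permDiag {d₁ d₂ : ℕ}
    {C : Matrix (Fin d₁ × Fin d₂) (Fin d₁ × Fin d₂) ℂ}
    (hC : C.IsHermitian) (π : Equiv.Perm (Fin (d₁ * d₂))) : (permDiag hC π).IsHermitian := by
  refine Matrix.isHermitian_diagonal_of_self_adjoint _ ?_
  ext p
  simp

/-- The vector `x↓` of the entries of `x` in decreasing order. -/
noncomputable def decr {n : ℕ} (x : Fin n → ℝ) : Fin n → ℝ :=
  x ∘ Tuple.sort (fun i => -x i)

theorem decr_antitone {n : ℕ} (x : Fin n → ℝ) : Antitone (decr x) := by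
  intro i j hij
  have h := Tuple.monotone_sort (fun i => -x i) hij
  simpa [decr] using h

/-- Majorization `x ≼ y`: for each `k`, the sum of the `k` largest entries of `x` is at most the
sum of the `k` largest entries of `y`, and the sums of all entries agree. -/
def MajorizedBy {n : ℕ} (x y : Fin n → ℝ) : Prop :=
  (∀ k : ℕ, 1 ≤ k → k ≤ n →
    ∑ i ∈ Finset.univ.filter (fun i : Fin n => i.val < k), decr x i ≤
      ∑ i ∈ Finset.univ.filter (fun i : Fin n => i.val < k), decr y i) ∧
  ∑ i, x i = ∑ i, y i

end BipartiteSpectra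

/-! In a product basis of eigenvectors of the two partial traces, the joint spectrum of `U * C * Uᴴ`
consists of the column and row sums of the diagonal, which is `lam` times a `d × d` table with
entries in `[0, 1]` and total `r`. Conversely, permuting an eigenbasis of `C` realizes every 0/1
table with `r` ones. So the question is whether some set `S` of `r` cells has margins that majorize
those of every such table.

Majorization compares sums over `k` lines. For rows `R` and columns `T` this sum is the weight in
`R` plus the weight in `T`, so cells of `R × T` count twice. Complementing tables turns margins `x`
into `d - x`, preserves majorization and exchanges `r` with `d² - r`.

If `r ≤ 3`, take `S` inside one row: `k` lines collect `r + min r (k - 1)`, while any table gives at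
most `r + min r (|R| |T|)`. The product `|R| |T|` first exceeds `k - 1` at `k = 4`, too late to
matter (`sumsDominated_of_row`).

If `4 ≤ r ≤ d² / 2`, testing `k = 1` forces `S` to have `min r d` cells on one line (`exists_line`).
For `r ≤ d` this makes `S` part of a line, where four lines collect at most `r + 3`; a set inside
two rows containing a 2 × 2 block gives at least `r + 4`. For `r ≥ d`, compare with a set inside an
`m × m` square: `2m` lines collect `2r`, so `S` lies in some `R × T` with `|R| + |T| = 2m`. The full
line makes one side `d`, hence `r ≤ (2m - d) d`, which the choice of `m` excludes
(`exists_square_side`). -/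

namespace BipartiteSpectra

/-! ### Majorization through subset sums -/

/-- Every sum of entries of `x` is bounded by a sum of equally many entries of `y`. -/
def SumsDominated {n : ℕ} (x y : Fin n → ℝ) : Prop :=
  ∀ I : Finset (Fin n), ∃ J : Finset (Fin n), J.card = I.card ∧ ∑ i ∈ I, x i ≤ ∑ j ∈ J, y j

theorem card_filter_val_lt {n k : ℕ} (hk : k ≤ n) :
    (Finset.univ.filter (fun i : Fin n => i.val < k)).card = k := by
  rw [Fin.card_filter_val_lt, min_eq_right hk]

/-- Exchange argument: indices of `I` outside the initial segment are matched with the equally many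
indices of the segment outside `I`, all of which come earlier. -/
theorem Antitone.sum_le_sum_filter_val_lt {n : ℕ} {x : Fin n → ℝ} (hx : Antitone x)
    (I : Finset (Fin n)) :
    ∑ i ∈ I, x i ≤ ∑ i ∈ Finset.univ.filter (fun i : Fin n => i.val < I.card), x i := by
  set F := Finset.univ.filter (fun i : Fin n => i.val < I.card) with hF
  have hcard : F.card = I.card := card_filter_val_lt (by simpa using I.card_le_univ)
  have hdiff : (I \ F).card = (F \ I).card := Finset.card_sdiff_comm hcard.symm
  rw [← Finset.sum_sdiff_le_sum_sdiff]
  let e := Finset.equivOfCardEq hdiff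
  rw [← Finset.sum_coe_sort (I \ F), ← Finset.sum_coe_sort (F \ I), ← e.sum_comp]
  refine Finset.sum_le_sum fun i _ => hx ?_
  have h1 := i.2
  have h2 := (e i).2
  simp only [hF, Finset.mem_sdiff, Finset.mem_filter, Finset.mem_univ, true_and] at h1 h2
  exact Fin.le_def.2 (by omega)

theorem sum_le_sum_decr {n : ℕ} (x : Fin n → ℝ) (I : Finset (Fin n)) :
    ∑ i ∈ I, x i ≤ ∑ i ∈ Finset.univ.filter (fun i : Fin n => i.val < I.card), decr x i := by
  have h := Antitone.sum_le_sum_filter_val_lt (decr_antitone x)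
    (I.map (Tuple.sort (fun i => -x i)).symm.toEmbedding)
  simpa [decr] using h

theorem exists_sum_eq_sum_decr {n k : ℕ} (x : Fin n → ℝ) (hk : k ≤ n) :
    ∃ I : Finset (Fin n), I.card = k ∧
      ∑ i ∈ Finset.univ.filter (fun i : Fin n => i.val < k), decr x i = ∑ i ∈ I, x i :=
  ⟨(Finset.univ.filter (fun i : Fin n => i.val < k)).map
    (Tuple.sort (fun i => -x i)).toEmbedding, by simp [card_filter_val_lt hk], by simp [decr]⟩

theorem majorizedBy_iff {n : ℕ} {x y : Fin n → ℝ} :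
    MajorizedBy x y ↔ SumsDominated x y ∧ ∑ i, x i = ∑ i, y i := by
  refine and_congr_left fun _ => ⟨fun h I => ?_, fun h k _ hk => ?_⟩
  · have hI : I.card ≤ n := by simpa using I.card_le_univ
    obtain ⟨J, hJ, hJs⟩ := exists_sum_eq_sum_decr y hI
    refine ⟨J, hJ, (sum_le_sum_decr x I).trans ?_⟩
    rw [← hJs]
    rcases Nat.eq_zero_or_pos I.card with h0 | h0
    · simp [h0]
    · exact h _ h0 hI
  · obtain ⟨I, hI, hIs⟩ := exists_sum_eq_sum_decr x hk
    obtain ⟨J, hJ, hJs⟩ := h I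
    rw [hIs]
    refine hJs.trans ((sum_le_sum_decr y J).trans_eq ?_)
    rw [hJ, hI]

theorem SumsDominated.comp_perm {n : ℕ} {x y : Fin n → ℝ} (h : SumsDominated x y)
    (σ τ : Equiv.Perm (Fin n)) : SumsDominated (x ∘ σ) (y ∘ τ) := by
  intro I
  obtain ⟨J, hJ, hs⟩ := h (I.map σ.toEmbedding)
  exact ⟨J.map τ.symm.toEmbedding, by simpa using hJ, by simpa using hs⟩

theorem sumsDominated_comp_perm_iff {n : ℕ} {x y : Fin n → ℝ} (σ τ : Equiv.Perm (Fin n)) :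
    SumsDominated (x ∘ σ) (y ∘ τ) ↔ SumsDominated x y := by
  refine ⟨fun h => ?_, fun h => h.comp_perm σ τ⟩
  have := h.comp_perm σ⁻¹ τ⁻¹
  rwa [Function.comp_assoc, Function.comp_assoc, ← Equiv.Perm.coe_mul, ← Equiv.Perm.coe_mul,
    mul_inv_cancel, mul_inv_cancel] at this

theorem SumsDominated.const_mul {n : ℕ} {x y : Fin n → ℝ} (h : SumsDominated x y) {c : ℝ}
    (hc : 0 ≤ c) : SumsDominated (fun i => c * x i) (fun i => c * y i) := by
  intro I
  obtain ⟨J, hJ, hs⟩ := h I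
  exact ⟨J, hJ, by simpa only [← Finset.mul_sum] using mul_le_mul_of_nonneg_left hs hc⟩

/-- With equal totals, a bound on the sum over the complement of `I` reverses into one for the
negated entries over `I`. -/
theorem SumsDominated.const_sub {n : ℕ} {x y : Fin n → ℝ} (h : SumsDominated x y)
    (hs : ∑ i, x i = ∑ i, y i) (c : ℝ) :
    SumsDominated (fun i => c - x i) (fun i => c - y i) := by
  intro I
  obtain ⟨J, hJ, hle⟩ := h Iᶜ
  have hJc : Jᶜ.card = I.card := by
    have h1 := Finset.card_add_card_compl I
    have h2 := Finset.card_add_card_compl J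
    omega
  refine ⟨Jᶜ, hJc, ?_⟩
  have h1 := Finset.sum_add_sum_compl I x
  have h2 := Finset.sum_add_sum_compl J y
  simp only [Finset.sum_sub_distrib, Finset.sum_const, hJc]
  linarith

/-! ### Row and column sums of tables -/

/-- The column sums followed by the row sums of a table. -/
def margins {d₁ d₂ : ℕ} (y : Fin d₁ × Fin d₂ → ℝ) : Fin (d₂ + d₁) → ℝ :=
  Fin.append (fun s => ∑ i, y (i, s)) (fun i => ∑ s, y (i, s))

theorem sum_margins {d₁ d₂ : ℕ} (y : Fin d₁ × Fin d₂ → ℝ) :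
    ∑ j, margins y j = 2 * ∑ p, y p := by
  simp only [margins, Fin.sum_univ_add, Fin.append_left, Fin.append_right]
  rw [Fintype.sum_prod_type, Finset.sum_comm, two_mul]

theorem margins_const_mul {d₁ d₂ : ℕ} (c : ℝ) (y : Fin d₁ × Fin d₂ → ℝ) :
    margins (fun p => c * y p) = fun j => c * margins y j := by
  funext j
  refine Fin.addCases (fun s => ?_) (fun i => ?_) j <;> simp [margins, Finset.mul_sum]

theorem margins_one_sub {d : ℕ} (y : Fin d × Fin d → ℝ) :
    margins (fun p => 1 - y p) = fun j => (d : ℝ) - margins y j := by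
  funext j
  refine Fin.addCases (fun s => ?_) (fun i => ?_) j <;>
    simp only [margins, Fin.append_left, Fin.append_right] <;> simp

theorem margins_nonneg {d₁ d₂ : ℕ} {y : Fin d₁ × Fin d₂ → ℝ} (hy : ∀ p, 0 ≤ y p)
    (j : Fin (d₂ + d₁)) : 0 ≤ margins y j := by
  refine Fin.addCases (fun s => ?_) (fun i => ?_) j <;>
    simpa [margins] using Finset.sum_nonneg fun _ _ => hy _

/-- The index set of the columns in `T` and the rows in `R`. -/
def lines {d₁ d₂ : ℕ} (R : Finset (Fin d₁)) (T : Finset (Fin d₂)) : Finset (Fin (d₂ + d₁)) :=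
  (T.disjSum R).map finSumFinEquiv.toEmbedding

theorem card_lines {d₁ d₂ : ℕ} (R : Finset (Fin d₁)) (T : Finset (Fin d₂)) :
    (lines R T).card = R.card + T.card := by
  simp [lines, add_comm]

theorem exists_eq_lines {d₁ d₂ : ℕ} (I : Finset (Fin (d₂ + d₁))) :
    ∃ (R : Finset (Fin d₁)) (T : Finset (Fin d₂)), I = lines R T := by
  refine ⟨(I.map finSumFinEquiv.symm.toEmbedding).toRight,
    (I.map finSumFinEquiv.symm.toEmbedding).toLeft, ?_⟩
  rw [lines, Finset.toLeft_disjSum_toRight]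
  ext j
  simp

theorem sum_lines_margins {d₁ d₂ : ℕ} (y : Fin d₁ × Fin d₂ → ℝ) (R : Finset (Fin d₁))
    (T : Finset (Fin d₂)) :
    ∑ j ∈ lines R T, margins y j =
      ∑ p with p.1 ∈ R, y p + ∑ p with p.2 ∈ T, y p := by
  have h1 : ∑ p with p.1 ∈ R, y p = ∑ i ∈ R, ∑ s, y (i, s) := by
    rw [← Finset.sum_product' R Finset.univ (fun i s => y (i, s))]
    exact Finset.sum_congr (by ext; simp) fun _ _ => rfl
  have h2 : ∑ p with p.2 ∈ T, y p = ∑ s ∈ T, ∑ i, y (i, s) := by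
    rw [← Finset.sum_product_right' Finset.univ T (fun i s => y (i, s))]
    exact Finset.sum_congr (by ext; simp) fun _ _ => rfl
  rw [h1, h2, lines, Finset.sum_map, Finset.sum_disjSum, add_comm]
  simp [margins]

/-- The indicator table of a set of positions. -/
def indic {α : Type*} [DecidableEq α] (S : Finset α) : α → ℝ := fun p => if p ∈ S then 1 else 0

theorem sum_indic {α : Type*} [DecidableEq α] [Fintype α] (S : Finset α) :
    ∑ p, indic S p = S.card := by
  simp [indic]

theorem indic_compl {α : Type*} [DecidableEq α] [Fintype α] (S : Finset α) :
    indic Sᶜ = fun p => 1 - indic S p := by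
  funext p
  by_cases h : p ∈ S <;> simp [indic, h]

theorem sum_lines_indic {d₁ d₂ : ℕ} (S : Finset (Fin d₁ × Fin d₂)) (R : Finset (Fin d₁))
    (T : Finset (Fin d₂)) :
    ∑ j ∈ lines R T, margins (indic S) j =
      (((S.filter fun p => p.1 ∈ R).card + (S.filter fun p => p.2 ∈ T).card : ℕ) : ℝ) := by
  rw [sum_lines_margins]
  simp only [indic, Finset.sum_boole, Finset.filter_filter, Nat.cast_add]
  congr 3 <;> · ext; simp [and_comm]

theorem sumsDominated_indic_compl {d : ℕ} {S S' : Finset (Fin d × Fin d)}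
    (hc : S'.card = S.card) (h : SumsDominated (margins (indic S')) (margins (indic S))) :
    SumsDominated (margins (indic S'ᶜ)) (margins (indic Sᶜ)) := by
  rw [indic_compl, indic_compl, margins_one_sub, margins_one_sub]
  refine h.const_sub ?_ _
  rw [sum_margins, sum_margins, sum_indic, sum_indic, hc]

/-! ### Rearrangements and unitary diagonalization -/

theorem exists_perm_of_map_univ_eq {α β : Type*} [Fintype α] [DecidableEq β] {f g : α → β}
    (h : Finset.univ.val.map f = Finset.univ.val.map g) :
    ∃ σ : Equiv.Perm α, f = g ∘ σ := by
  classical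
  have hcard : ∀ c, Fintype.card {a // f a = c} = Fintype.card {a // g a = c} := by
    intro c
    have := congrArg (Multiset.count c) h
    rw [Multiset.count_map, Multiset.count_map] at this
    rw [Fintype.card_subtype, Fintype.card_subtype]
    simpa [Finset.card, eq_comm] using this
  refine ⟨Equiv.ofFiberEquiv fun c => Fintype.equivOfCardEq (hcard c), ?_⟩
  funext a
  exact (Equiv.ofFiberEquiv_map _ a).symm

theorem exists_perm_mem_iff {α : Type*} [Fintype α] [DecidableEq α] {S S' : Finset α}
    (h : S'.card = S.card) : ∃ σ : Equiv.Perm α, ∀ a, σ a ∈ S ↔ a ∈ S' := by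
  let e : {a // a ∈ S'} ≃ {a // a ∈ S} := Finset.equivOfCardEq h
  refine ⟨e.extendSubtype, fun a => ⟨fun ha => ?_, fun ha => e.extendSubtype_mem a ha⟩⟩
  by_contra hn
  exact e.extendSubtype_not_mem a hn ha

/-- `eigs` lists the values of `eigenvalues`. -/
theorem exists_eigs_eq {n : Type*} [Fintype n] [DecidableEq n] {N : ℕ} {A : Matrix n n ℂ}
    (hA : A.IsHermitian) (hN : Fintype.card n = N) :
    ∃ e : n ≃ Fin N, ∀ i, hA.eigenvalues i = eigs hA hN (e i) := by
  refine ⟨(Fintype.equivOfCardEq (Fintype.card_fin _)).symm.trans (finCongr hN), fun i => ?_⟩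
  simp [eigs, Matrix.IsHermitian.eigenvalues]

theorem exists_unitary_diagonal_eigenvalues {n : Type*} [Fintype n] [DecidableEq n]
    {A : Matrix n n ℂ} (hA : A.IsHermitian) :
    ∃ V ∈ Matrix.unitaryGroup n ℂ,
      Vᴴ * A * V = Matrix.diagonal fun k => ((hA.eigenvalues k : ℝ) : ℂ) := by
  refine ⟨↑hA.eigenvectorUnitary, hA.eigenvectorUnitary.2, ?_⟩
  have := hA.conjStarAlgAut_star_eigenvectorUnitary
  rw [Unitary.conjStarAlgAut_apply] at this
  simpa [Matrix.star_eq_conjTranspose, Function.comp_def] using this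

theorem submatrix_mem_unitaryGroup {n : Type*} [Fintype n] [DecidableEq n] {V : Matrix n n ℂ}
    (hV : V ∈ Matrix.unitaryGroup n ℂ) (σ : Equiv.Perm n) :
    V.submatrix id σ ∈ Matrix.unitaryGroup n ℂ := by
  rw [Matrix.mem_unitaryGroup_iff', Matrix.star_eq_conjTranspose, Matrix.conjTranspose_submatrix,
    ← Matrix.submatrix_mul _ _ _ _ _ Function.bijective_id, ← Matrix.star_eq_conjTranspose,
    Matrix.mem_unitaryGroup_iff'.1 hV]
  simp

theorem conj_submatrix {n : Type*} [Fintype n] (A V : Matrix n n ℂ) (σ : Equiv.Perm n) :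
    (V.submatrix id σ)ᴴ * A * V.submatrix id σ = (Vᴴ * A * V).submatrix σ σ := by
  rw [Matrix.submatrix_mul _ _ _ id _ Function.bijective_id,
    Matrix.submatrix_mul _ _ _ id _ Function.bijective_id]
  simp

theorem exists_unitary_diagonal_eigs {N : ℕ} {A : Matrix (Fin N) (Fin N) ℂ}
    (hA : A.IsHermitian) :
    ∃ V ∈ Matrix.unitaryGroup (Fin N) ℂ,
      Vᴴ * A * V = Matrix.diagonal fun k => ((eigs hA (Fintype.card_fin N) k : ℝ) : ℂ) := by
  obtain ⟨e, he⟩ := exists_eigs_eq hA (Fintype.card_fin N)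
  obtain ⟨V, hV, hd⟩ := exists_unitary_diagonal_eigenvalues hA
  refine ⟨V.submatrix id e.symm, submatrix_mem_unitaryGroup hV _, ?_⟩
  rw [conj_submatrix, hd, Matrix.submatrix_diagonal_equiv]
  congr 1
  funext k
  simp [he]

/-- The roots of the characteristic polynomial, as a multiset, are both the eigenvalues and the
diagonal entries. -/
theorem exists_perm_eigs_diagonal {N : ℕ} {A : Matrix (Fin N) (Fin N) ℂ} (hA : A.IsHermitian)
    {w : Fin N → ℝ} (hw : A = Matrix.diagonal fun k => (w k : ℂ)) :
    ∃ σ : Equiv.Perm (Fin N), eigs hA (Fintype.card_fin N) = w ∘ σ := by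
  obtain ⟨e, he⟩ := exists_eigs_eq hA (Fintype.card_fin N)
  have h := hA.roots_charpoly_eq_eigenvalues
  have h2 : A.charpoly.roots = Finset.univ.val.map (fun k => (w k : ℂ)) := by
    rw [hw, Matrix.charpoly_diagonal, Polynomial.roots_prod _ _
      (Finset.prod_ne_zero_iff.2 fun i _ => Polynomial.X_sub_C_ne_zero _)]
    simp [Multiset.bind_singleton]
  rw [h2] at h
  obtain ⟨σ, hσ⟩ := exists_perm_of_map_univ_eq h
  refine ⟨e.symm.trans σ.symm, ?_⟩
  funext k
  have h3 := congrFun hσ (σ.symm (e.symm k))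
  have h4 := he (e.symm k)
  simp only [Function.comp_apply, Equiv.apply_symm_apply] at h3 h4
  simp only [Function.comp_apply, Equiv.trans_apply]
  rw [← h4]
  exact Complex.ofReal_injective h3.symm

/-! ### Partial traces and the joint spectrum -/

theorem trOne_diagonal {d₁ d₂ : ℕ} (w : Fin d₁ × Fin d₂ → ℂ) :
    trOne (Matrix.diagonal w) = Matrix.diagonal fun s => ∑ i, w (i, s) := by
  ext s t
  by_cases h : s = t <;> simp [trOne, Matrix.diagonal_apply, h]

theorem trTwo_diagonal {d₁ d₂ : ℕ} (w : Fin d₁ × Fin d₂ → ℂ) :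
    trTwo (Matrix.diagonal w) = Matrix.diagonal fun i => ∑ s, w (i, s) := by
  ext s t
  by_cases h : s = t <;> simp [trTwo, Matrix.diagonal_apply, h]

theorem exists_perm_jointSpec_diagonal {d₁ d₂ : ℕ}
    {X : Matrix (Fin d₁ × Fin d₂) (Fin d₁ × Fin d₂) ℂ} (hX : X.IsHermitian)
    {w : Fin d₁ × Fin d₂ → ℝ} (hw : X = Matrix.diagonal fun p => (w p : ℂ)) :
    ∃ σ : Equiv.Perm (Fin (d₂ + d₁)), jointSpec hX = margins w ∘ σ := by
  obtain ⟨σ, hσ⟩ := exists_perm_eigs_diagonal (isHermitian_trOne hX)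
    (w := fun s => ∑ i, w (i, s)) (by rw [hw, trOne_diagonal]; simp)
  obtain ⟨τ, hτ⟩ := exists_perm_eigs_diagonal (isHermitian_trTwo hX)
    (w := fun i => ∑ s, w (i, s)) (by rw [hw, trTwo_diagonal]; simp)
  refine ⟨finSumFinEquiv.permCongr (Equiv.sumCongr σ τ), ?_⟩
  funext j
  refine Fin.addCases (fun s => ?_) (fun i => ?_) j
  · simp [jointSpec, hσ, margins, Equiv.permCongr_apply]
  · simp only [jointSpec, hτ, margins, Function.comp_apply, Equiv.permCongr_apply,
      Fin.append_right, finSumFinEquiv_symm_apply_natAdd, Equiv.sumCongr_apply, Sum.map_inr,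
      finSumFinEquiv_apply_right]

/-- Tracing out the first factor cancels `A` because its rows are orthonormal; `B` needs no
unitarity. -/
theorem trOne_conj_kronecker {d₁ d₂ : ℕ} (X : Matrix (Fin d₁ × Fin d₂) (Fin d₁ × Fin d₂) ℂ)
    {A : Matrix (Fin d₁) (Fin d₁) ℂ} (hA : A ∈ Matrix.unitaryGroup (Fin d₁) ℂ)
    (B : Matrix (Fin d₂) (Fin d₂) ℂ) :
    trOne ((Matrix.kroneckerMap (· * ·) A B)ᴴ * X * Matrix.kroneckerMap (· * ·) A B) =
      Bᴴ * trOne X * B := by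
  have hAA : ∀ j j', ∑ i, A j' i * star (A j i) = if j' = j then 1 else 0 := fun j j' => by
    have := congrFun (congrFun (Matrix.mem_unitaryGroup_iff.1 hA) j') j
    simpa [Matrix.mul_apply, Matrix.star_apply, Matrix.one_apply] using this
  ext s s'
  calc _ = ∑ i, ∑ q : Fin d₁ × Fin d₂, ∑ p : Fin d₁ × Fin d₂,
        star (B p.2 s) * X p q * B q.2 s' * (A q.1 i * star (A p.1 i)) := by
        simp only [trOne, Matrix.of_apply, Matrix.mul_apply, Matrix.conjTranspose_apply,
          Matrix.kroneckerMap_apply, Finset.sum_mul, star_mul']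
        refine Finset.sum_congr rfl fun i _ => Finset.sum_congr rfl fun q _ =>
          Finset.sum_congr rfl fun p _ => by ring
    _ = ∑ q : Fin d₁ × Fin d₂, ∑ p : Fin d₁ × Fin d₂,
        star (B p.2 s) * X p q * B q.2 s' * (if q.1 = p.1 then 1 else 0) := by
        rw [Finset.sum_comm]
        refine Finset.sum_congr rfl fun q _ => ?_
        rw [Finset.sum_comm]
        refine Finset.sum_congr rfl fun p _ => ?_
        rw [← Finset.mul_sum, hAA]
    _ = _ := by
        simp only [trOne, Matrix.of_apply, Matrix.mul_apply, Matrix.conjTranspose_apply,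
          Finset.sum_mul, Finset.mul_sum, Fintype.sum_prod_type, mul_ite, mul_one, mul_zero]
        rw [Finset.sum_comm]
        refine Finset.sum_congr rfl fun t' _ => ?_
        have : ∀ x : Fin d₁, (∑ x₁ : Fin d₁, ∑ x₂ : Fin d₂,
            if x = x₁ then star (B x₂ s) * X (x₁, x₂) (x, t') * B t' s' else 0) =
            ∑ x₂ : Fin d₂, star (B x₂ s) * X (x, x₂) (x, t') * B t' s' := fun x => by
          rw [Finset.sum_comm]
          simp
        simp only [this]
        rw [Finset.sum_comm]

theorem trTwo_conj_kronecker {d₁ d₂ : ℕ} (X : Matrix (Fin d₁ × Fin d₂) (Fin d₁ × Fin d₂) ℂ)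
    (A : Matrix (Fin d₁) (Fin d₁) ℂ) {B : Matrix (Fin d₂) (Fin d₂) ℂ}
    (hB : B ∈ Matrix.unitaryGroup (Fin d₂) ℂ) :
    trTwo ((Matrix.kroneckerMap (· * ·) A B)ᴴ * X * Matrix.kroneckerMap (· * ·) A B) =
      Aᴴ * trTwo X * A := by
  -- Exchanging the two tensor factors turns the second partial trace into the first.
  have h := trOne_conj_kronecker (X.submatrix Prod.swap Prod.swap) hB A
  have e : ((Matrix.kroneckerMap (· * ·) A B)ᴴ * X * Matrix.kroneckerMap (· * ·) A B).submatrix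
      Prod.swap Prod.swap = (Matrix.kroneckerMap (· * ·) B A)ᴴ * X.submatrix Prod.swap Prod.swap *
        Matrix.kroneckerMap (· * ·) B A := by
    rw [Matrix.submatrix_mul _ _ _ Prod.swap _ Prod.swap_bijective,
      Matrix.submatrix_mul _ _ _ Prod.swap _ Prod.swap_bijective]
    congr 1
    · congr 1
      ext p q
      simp [mul_comm]
    · ext p q
      simp [mul_comm]
  rw [← e] at h
  exact h

/-- The joint spectrum of `X` is read off the diagonal of `X` in a product basis of
eigenvectors of the two partial traces. -/
theorem exists_jointSpec_eq_margins {d₁ d₂ : ℕ}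
    {X : Matrix (Fin d₁ × Fin d₂) (Fin d₁ × Fin d₂) ℂ} (hX : X.IsHermitian) :
    ∃ W ∈ Matrix.unitaryGroup (Fin d₁ × Fin d₂) ℂ,
      jointSpec hX = margins fun p => ((Wᴴ * X * W) p p).re := by
  obtain ⟨B, hB, hBd⟩ := exists_unitary_diagonal_eigs (isHermitian_trOne hX)
  obtain ⟨A, hA, hAd⟩ := exists_unitary_diagonal_eigs (isHermitian_trTwo hX)
  refine ⟨Matrix.kroneckerMap (· * ·) A B, Matrix.kronecker_mem_unitary hA hB, ?_⟩
  rw [← trOne_conj_kronecker X hA B] at hBd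
  rw [← trTwo_conj_kronecker X A hB] at hAd
  funext j
  refine Fin.addCases (fun s => ?_) (fun i => ?_) j
  · have := congrArg Complex.re (congrFun (congrFun hBd s) s)
    simp only [trOne, Matrix.of_apply, Complex.re_sum, Matrix.diagonal_apply_eq,
      Complex.ofReal_re] at this
    simp only [jointSpec, margins, Fin.append_left]
    exact this.symm
  · have := congrArg Complex.re (congrFun (congrFun hAd i) i)
    simp only [trTwo, Matrix.of_apply, Complex.re_sum, Matrix.diagonal_apply_eq,
      Complex.ofReal_re] at this
    simp only [jointSpec, margins, Fin.append_right]
    exact this.symm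

/-! ### Diagonals of unitary conjugates -/

theorem re_conj_diagonal_apply {n : Type*} [Fintype n] [DecidableEq n] (Z : Matrix n n ℂ)
    (w : n → ℝ) (p : n) :
    ((Z * Matrix.diagonal (fun q => (w q : ℂ)) * Zᴴ) p p).re =
      ∑ q, w q * Complex.normSq (Z p q) := by
  rw [Matrix.mul_apply, Complex.re_sum]
  refine Finset.sum_congr rfl fun q _ => ?_
  rw [Matrix.mul_diagonal, Matrix.conjTranspose_apply, mul_right_comm, Complex.star_def,
    Complex.mul_conj, mul_comm, ← Complex.ofReal_mul, Complex.ofReal_re]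

theorem sum_normSq_row {n : Type*} [Fintype n] [DecidableEq n] {Z : Matrix n n ℂ}
    (hZ : Z ∈ Matrix.unitaryGroup n ℂ) (p : n) : ∑ q, Complex.normSq (Z p q) = 1 := by
  have := congrArg Complex.re (congrFun (congrFun (Matrix.mem_unitaryGroup_iff.1 hZ) p) p)
  simpa [Matrix.mul_apply, Matrix.star_apply, Complex.mul_conj, -Complex.mul_re] using this

theorem sum_normSq_col {n : Type*} [Fintype n] [DecidableEq n] {Z : Matrix n n ℂ}
    (hZ : Z ∈ Matrix.unitaryGroup n ℂ) (q : n) : ∑ p, Complex.normSq (Z p q) = 1 := by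
  have := sum_normSq_row (Unitary.star_mem hZ) q
  simpa [Matrix.star_apply] using this

/-- The diagonal of a unitary conjugate of `lam` times a coordinate projection. -/
theorem exists_fractional_diag {n : Type*} [Fintype n] [DecidableEq n] {Z : Matrix n n ℂ}
    (hZ : Z ∈ Matrix.unitaryGroup n ℂ) (lam : ℝ) (S : Finset n) :
    ∃ z : n → ℝ, (∀ p, 0 ≤ z p) ∧ (∀ p, z p ≤ 1) ∧ ∑ p, z p = S.card ∧
      ∀ p, ((Z * Matrix.diagonal (fun q => ((lam * indic S q : ℝ) : ℂ)) * Zᴴ) p p).re =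
        lam * z p := by
  have h0 : ∀ q, 0 ≤ indic S q := fun q => by unfold indic; split_ifs <;> norm_num
  have h1 : ∀ q, indic S q ≤ 1 := fun q => by unfold indic; split_ifs <;> norm_num
  -- The squared moduli of the entries of `Z` form a doubly stochastic matrix: row sums give `z ≤
  -- 1`, column sums give the total.
  refine ⟨fun p => ∑ q, indic S q * Complex.normSq (Z p q), fun p => ?_, fun p => ?_, ?_,
    fun p => ?_⟩
  · exact Finset.sum_nonneg fun q _ => mul_nonneg (h0 q) (Complex.normSq_nonneg _)
  · rw [← sum_normSq_row hZ p]
    exact Finset.sum_le_sum fun q _ => mul_le_of_le_one_left (Complex.normSq_nonneg _) (h1 q)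
  · rw [Finset.sum_comm, ← sum_indic]
    refine Finset.sum_congr rfl fun q _ => ?_
    rw [← Finset.mul_sum, sum_normSq_col hZ, mul_one]
  · rw [re_conj_diagonal_apply, Finset.mul_sum]
    simp only [mul_assoc]

/-! ### Small totals: one row is optimal -/

section Tables

variable {d : ℕ}

/-- Any table with entries in `[0, 1]` and total `r ≤ 3` is dominated by `r` ones in a row. -/
theorem sumsDominated_of_row (hd : 3 ≤ d) {r : ℕ} (hr : r ≤ 3) {S : Finset (Fin d × Fin d)}
    (hS : ∀ p : Fin d × Fin d, p ∈ S ↔ p.1.val = 0 ∧ p.2.val < r) (hSc : S.card = r)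
    {z : Fin d × Fin d → ℝ} (h0 : ∀ p, 0 ≤ z p) (h1 : ∀ p, z p ≤ 1) (hz : ∑ p, z p = r) :
    SumsDominated (margins z) (margins (indic S)) := by
  intro I
  have hnn : ∀ j, 0 ≤ margins (indic S) j :=
    margins_nonneg fun p => by unfold indic; split_ifs <;> norm_num
  obtain ⟨R, T, rfl⟩ := exists_eq_lines I
  rcases Nat.eq_zero_or_pos (lines R T).card with hI | hI
  · exact ⟨lines R T, rfl, by simp [Finset.card_eq_zero.1 hI]⟩
  -- The competitor is the occupied row with `m` columns meeting its ones. These are at most `k`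
  -- lines collecting at least `r + m`, and padding to exactly `k` lines loses nothing since margins
  -- are nonnegative.
  set m := min r ((lines R T).card - 1) with hm
  let R₀ : Finset (Fin d) := {⟨0, by omega⟩}
  let T₀ : Finset (Fin d) := Finset.univ.filter fun s => s.val < m
  have hT₀ : T₀.card = m := card_filter_val_lt (by omega)
  have hR₀ : R₀.card = 1 := Finset.card_singleton _
  obtain ⟨J, hJ, hJc⟩ := Finset.exists_superset_card_eq (s := lines R₀ T₀)
    (n := (lines R T).card) (by rw [card_lines, hT₀, hR₀]; omega) (Finset.card_le_univ _)
  refine ⟨J, hJc, le_trans ?_ (Finset.sum_le_sum_of_subset_of_nonneg hJ fun j _ _ => hnn j)⟩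
  have hA : (S.filter fun p => p.1 ∈ R₀).card = r := by
    rw [Finset.filter_true_of_mem, hSc]
    intro p hp
    simpa [R₀, Fin.ext_iff] using ((hS p).1 hp).1
  have hB : m ≤ (S.filter fun p => p.2 ∈ T₀).card := by
    rw [← hT₀]
    refine Finset.card_le_card_of_injOn (fun s => (⟨0, by omega⟩, s)) (fun s hs => ?_)
      (fun s _ t _ h => congrArg Prod.snd h)
    have hs' : s.val < m := by simpa [T₀] using hs
    refine Finset.mem_coe.2 (Finset.mem_filter.2 ⟨(hS _).2 ⟨rfl, ?_⟩, hs⟩)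
    exact (show s.val < r by omega)
  rw [sum_lines_indic, sum_lines_margins, hA]
  have hle1 : ∑ p with p.1 ∈ R, z p ≤ r := by
    rw [← hz]
    exact Finset.sum_le_sum_of_subset_of_nonneg (Finset.subset_univ _) fun p _ _ => h0 p
  have hle2 : ∑ p with p.2 ∈ T, z p ≤ r := by
    rw [← hz]
    exact Finset.sum_le_sum_of_subset_of_nonneg (Finset.subset_univ _) fun p _ _ => h0 p
  -- Inclusion–exclusion: the union weighs at most `r`, and the doubly counted block `R ×ˢ T` at
  -- most its number of cells.
  have hle3 : ∑ p with p.1 ∈ R, z p + ∑ p with p.2 ∈ T, z p ≤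
      r + (R.card * T.card : ℕ) := by
    have hprod : ∑ p ∈ R ×ˢ T, z p ≤ (R.card * T.card : ℕ) := by
      refine (Finset.sum_le_card_nsmul _ _ 1 fun p _ => h1 p).trans_eq ?_
      simp
    have e : R ×ˢ T = (Finset.univ.filter fun p : Fin d × Fin d => p.1 ∈ R) ∩
        (Finset.univ.filter fun p : Fin d × Fin d => p.2 ∈ T) := by
      ext p
      simp
    rw [← Finset.sum_union_inter, ← e, ← hz]
    exact add_le_add (Finset.sum_le_sum_of_subset_of_nonneg (Finset.subset_univ _)
      fun p _ _ => h0 p) hprod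
  -- For one to three lines `|R| |T| ≤ |R| + |T| - 1`; from four lines on, `|R| + |T| - 1 ≥ 3 ≥ r`.
  have hmin : min r (R.card * T.card) ≤ m := by
    rw [hm, card_lines]
    rw [card_lines] at hI
    refine le_min (min_le_left _ _) ?_
    rcases Nat.lt_or_ge 3 (R.card + T.card) with h | h
    · omega
    · refine (min_le_right _ _).trans ?_
      have ha : R.card ≤ 3 := by omega
      have hb : T.card ≤ 3 := by omega
      interval_cases R.card <;> interval_cases T.card <;> omega
  refine le_trans ?_ (Nat.cast_le.2 (Nat.add_le_add_left (hmin.trans hB) r))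
  push_cast
  rw [← min_add_add_left]
  push_cast at hle3
  exact le_min (by linarith) hle3

/-! ### Obstructions for intermediate ranks -/

/-- The combinatorial form of domination of every table of `r` ones by a fixed one. -/
theorem exists_card_le_of_sumsDominated {S S' : Finset (Fin d × Fin d)}
    (h : SumsDominated (margins (indic S')) (margins (indic S))) (R' T' : Finset (Fin d)) :
    ∃ R T : Finset (Fin d), R.card + T.card = R'.card + T'.card ∧
      (S'.filter fun p => p.1 ∈ R').card + (S'.filter fun p => p.2 ∈ T').card ≤
        (S.filter fun p => p.1 ∈ R).card + (S.filter fun p => p.2 ∈ T).card := by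
  obtain ⟨J, hJ, hs⟩ := h (lines R' T')
  obtain ⟨R, T, rfl⟩ := exists_eq_lines J
  rw [sum_lines_indic, sum_lines_indic] at hs
  rw [card_lines, card_lines] at hJ
  exact ⟨R, T, hJ, by exact_mod_cast hs⟩

theorem card_filter_fst_le (S : Finset (Fin d × Fin d)) (R : Finset (Fin d)) :
    (S.filter fun p => p.1 ∈ R).card ≤ R.card * d := by
  have : (S.filter fun p => p.1 ∈ R) ⊆ R ×ˢ Finset.univ := fun p hp => by
    simpa using (Finset.mem_filter.1 hp).2
  simpa using Finset.card_le_card this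

theorem card_filter_snd_le (S : Finset (Fin d × Fin d)) (T : Finset (Fin d)) :
    (S.filter fun p => p.2 ∈ T).card ≤ T.card * d := by
  have : (S.filter fun p => p.2 ∈ T) ⊆ Finset.univ ×ˢ T := fun p hp => by
    simpa using (Finset.mem_filter.1 hp).2
  simpa [mul_comm] using Finset.card_le_card this

/-- If `S` dominates, some line contains `min r d` elements of `S`. -/
theorem exists_line {S : Finset (Fin d × Fin d)} (hd : 0 < d)
    (h : ∀ S' : Finset (Fin d × Fin d), S'.card = S.card →
      SumsDominated (margins (indic S')) (margins (indic S))) :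
    (∃ i, min S.card d ≤ (S.filter fun p => p.1 = i).card) ∨
      (∃ s, min S.card d ≤ (S.filter fun p => p.2 = s).card) := by
  let i₀ : Fin d := ⟨0, hd⟩
  let L : Finset (Fin d × Fin d) := {i₀} ×ˢ Finset.univ
  have hL : L.card = d := by simp [L]
  obtain ⟨A, hAL, hA⟩ := Finset.exists_subset_card_eq (s := L) (n := min S.card d) (by omega)
  obtain ⟨S', hAS, hS'⟩ := Finset.exists_superset_card_eq (s := A) (n := S.card) (by omega)
    (Finset.card_le_univ _)
  obtain ⟨R, T, hc, hle⟩ := exists_card_le_of_sumsDominated (h S' hS') {i₀} ∅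
  have hge : min S.card d ≤ (S'.filter fun p => p.1 ∈ ({i₀} : Finset (Fin d))).card := by
    rw [← hA]
    refine Finset.card_le_card fun p hp => Finset.mem_filter.2 ⟨hAS hp, ?_⟩
    exact (Finset.mem_product.1 (hAL hp)).1
  rw [Finset.card_singleton, Finset.card_empty] at hc
  rcases Nat.eq_zero_or_pos T.card with hT | hT
  · obtain ⟨i, rfl⟩ := Finset.card_eq_one.1 (show R.card = 1 by omega)
    rw [Finset.card_eq_zero.1 hT] at hle
    simp only [Finset.mem_singleton, Finset.notMem_empty, Finset.filter_false,
      Finset.card_empty] at hle hge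
    exact Or.inl ⟨i, by omega⟩
  · obtain ⟨s, rfl⟩ := Finset.card_eq_one.1 (show T.card = 1 by omega)
    rw [Finset.card_eq_zero.1 (show R.card = 0 by omega)] at hle
    simp only [Finset.mem_singleton, Finset.notMem_empty, Finset.filter_false,
      Finset.card_empty] at hle hge
    exact Or.inr ⟨s, by omega⟩

theorem card_filter_snd_le_of_row {S : Finset (Fin d × Fin d)} {i : Fin d}
    (h : ∀ p ∈ S, p.1 = i) (T : Finset (Fin d)) :
    (S.filter fun p => p.2 ∈ T).card ≤ T.card := by
  refine Finset.card_le_card_of_injOn Prod.snd (fun p hp => (Finset.mem_filter.1 hp).2)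
    fun p hp q hq hpq => Prod.ext ?_ hpq
  rw [h p (Finset.mem_filter.1 hp).1, h q (Finset.mem_filter.1 hq).1]

theorem card_filter_fst_le_of_col {S : Finset (Fin d × Fin d)} {s : Fin d}
    (h : ∀ p ∈ S, p.2 = s) (R : Finset (Fin d)) :
    (S.filter fun p => p.1 ∈ R).card ≤ R.card := by
  refine Finset.card_le_card_of_injOn Prod.fst (fun p hp => (Finset.mem_filter.1 hp).2)
    fun p hp q hq hpq => Prod.ext hpq ?_
  rw [h p (Finset.mem_filter.1 hp).1, h q (Finset.mem_filter.1 hq).1]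

theorem not_forall_sumsDominated_of_card_le {S : Finset (Fin d × Fin d)} (h4 : 4 ≤ S.card)
    (hSd : S.card ≤ d) (h : ∀ S' : Finset (Fin d × Fin d), S'.card = S.card →
      SumsDominated (margins (indic S')) (margins (indic S))) : False := by
  let P : Finset (Fin d) := Finset.univ.filter fun i => i.val < 2
  have hP : P.card = 2 := card_filter_val_lt (by omega)
  -- The test set contains a 2 × 2 block and stays within two rows, possible as `4 ≤ r ≤ 2d`.
  obtain ⟨S', hsub, hsup, hS'⟩ := Finset.exists_subsuperset_card_eq
    (s := P ×ˢ P) (t := P ×ˢ Finset.univ) (n := S.card)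
    (Finset.product_subset_product_right (Finset.subset_univ _))
    (by rw [Finset.card_product, hP]; omega)
    (by rw [Finset.card_product, hP, Finset.card_univ, Fintype.card_fin]; omega)
  obtain ⟨R, T, hc, hle⟩ := exists_card_le_of_sumsDominated (h S' hS') P P
  have h1 : (S'.filter fun p => p.1 ∈ P).card = S.card := by
    rw [Finset.filter_true_of_mem, hS']
    exact fun p hp => (Finset.mem_product.1 (hsup hp)).1
  have h2 : 4 ≤ (S'.filter fun p => p.2 ∈ P).card := by
    have : P ×ˢ P ⊆ S'.filter fun p => p.2 ∈ P := fun p hp =>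
      Finset.mem_filter.2 ⟨hsub hp, (Finset.mem_product.1 hp).2⟩
    have := Finset.card_le_card this
    rw [Finset.card_product, hP] at this
    omega
  have hR := Finset.card_filter_le S fun p => p.1 ∈ R
  have hT := Finset.card_filter_le S fun p => p.2 ∈ T
  rw [hP] at hc
  rcases exists_line (by omega) h with ⟨i, hi⟩ | ⟨s, hs⟩
  · rw [min_eq_left hSd] at hi
    have hrow : ∀ p ∈ S, p.1 = i := Finset.filter_card_eq
      (le_antisymm (Finset.card_filter_le _ _) hi)
    have := card_filter_snd_le_of_row hrow T
    -- All of `S` is in row `i`. Four columns alone collect at most `r`; with some row chosen, at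
    -- most three columns remain and add at most 3.
    rcases Nat.eq_zero_or_pos R.card with h0 | h0
    · rw [Finset.card_eq_zero.1 h0] at hle
      simp only [Finset.notMem_empty, Finset.filter_false, Finset.card_empty] at hle
      omega
    · omega
  · rw [min_eq_left hSd] at hs
    have hcol : ∀ p ∈ S, p.2 = s := Finset.filter_card_eq
      (le_antisymm (Finset.card_filter_le _ _) hs)
    have := card_filter_fst_le_of_col hcol R
    rcases Nat.eq_zero_or_pos T.card with h0 | h0
    · rw [Finset.card_eq_zero.1 h0] at hle
      simp only [Finset.notMem_empty, Finset.filter_false, Finset.card_empty] at hle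
      omega
    · omega

/-- A square of side `m` that holds `r ≤ d² / 2` cells is too small to reach across the table. -/
theorem exists_square_side {r : ℕ} (hd : 24 ≤ d) (hr0 : 0 < r) (hr : 2 * r ≤ d ^ 2) :
    ∃ m, r ≤ m * m ∧ m ≤ d ∧ 2 * d * m < d * d + r := by
  obtain ⟨n, hn1, hn2⟩ : ∃ n, n * n < r ∧ r ≤ (n + 1) * (n + 1) := by
    refine ⟨Nat.sqrt (r - 1), ?_, ?_⟩
    · have := Nat.sqrt_le (r - 1)
      omega
    · have := Nat.lt_succ_sqrt (r - 1)
      simp only [Nat.succ_eq_add_one] at this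
      omega
  -- From `n² < d² / 2`, with 0.71 slightly above `1 / √2`.
  have hn : 100 * n < 71 * d := by
    by_contra hcon
    push Not at hcon
    nlinarith
  refine ⟨n + 1, hn2, by omega, ?_⟩
  obtain ⟨c, rfl⟩ : ∃ c, d = n + 1 + c := ⟨d - (n + 1), by omega⟩
  -- For `m = n + 1` and `c = d - m`, `d² - 2dm = c² - m²`, so the goal reads `m² < c² + r`; since
  -- `n² < r`, this bound on `c²` suffices.
  have hc : 2 * n + 1 ≤ c * c := by
    have h1 : 29 * n < 71 * c + 71 := by omega
    have h2 : 6 ≤ c := by omega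
    rcases Nat.lt_or_ge c 7 with h | h
    · obtain rfl : c = 6 := by omega
      omega
    · nlinarith
  nlinarith

theorem not_forall_sumsDominated_of_le_card {S : Finset (Fin d × Fin d)} (hd : 24 ≤ d)
    (hdS : d ≤ S.card) (hS : 2 * S.card ≤ d ^ 2)
    (h : ∀ S' : Finset (Fin d × Fin d), S'.card = S.card →
      SumsDominated (margins (indic S')) (margins (indic S))) : False := by
  obtain ⟨m, hm1, hm2, hm3⟩ := exists_square_side hd (by omega) hS
  let P : Finset (Fin d) := Finset.univ.filter fun i => i.val < m
  have hP : P.card = m := card_filter_val_lt hm2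
  obtain ⟨S', hsub, hS'⟩ := Finset.exists_subset_card_eq (s := P ×ˢ P) (n := S.card)
    (by rw [Finset.card_product, hP]; exact hm1)
  obtain ⟨R, T, hc, hle⟩ := exists_card_le_of_sumsDominated (h S' hS') P P
  rw [Finset.filter_true_of_mem fun p hp => (Finset.mem_product.1 (hsub hp)).1,
    Finset.filter_true_of_mem fun p hp => (Finset.mem_product.1 (hsub hp)).2, hS'] at hle
  have hR := Finset.card_filter_le S fun p => p.1 ∈ R
  have hT := Finset.card_filter_le S fun p => p.2 ∈ T
  -- The two counts sum to at least `2r` and neither exceeds `r`, so both equal `r` and `S` lies in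
  -- `R × T`.
  have hRm : ∀ p ∈ S, p.1 ∈ R := Finset.filter_card_eq (by omega)
  have hTm : ∀ p ∈ S, p.2 ∈ T := Finset.filter_card_eq (by omega)
  have hR2 := card_filter_fst_le S R
  have hT2 := card_filter_snd_le S T
  rw [hP] at hc
  rcases exists_line (by omega) h with ⟨i, hi⟩ | ⟨s, hs⟩
  · rw [min_eq_right hdS] at hi
    -- Row `i` is full and its cells have columns in `T`. Then `|R| ≤ 2m - d`, so `r ≤ (2m - d) d`,
    -- against `hm3`.
    have : d ≤ T.card := hi.trans <| (Finset.card_le_card fun p hp =>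
      Finset.mem_filter.2 ⟨hp, hTm p (Finset.mem_filter.1 hp).1⟩).trans
      (card_filter_snd_le_of_row (fun p hp => (Finset.mem_filter.1 hp).2) T)
    nlinarith
  · rw [min_eq_right hdS] at hs
    have : d ≤ R.card := hs.trans <| (Finset.card_le_card fun p hp =>
      Finset.mem_filter.2 ⟨hp, hRm p (Finset.mem_filter.1 hp).1⟩).trans
      (card_filter_fst_le_of_col (fun p hp => (Finset.mem_filter.1 hp).2) R)
    nlinarith

theorem not_forall_sumsDominated {S : Finset (Fin d × Fin d)} (hd : 24 ≤ d)
    (h4 : 4 ≤ S.card) (hS : S.card + 4 ≤ d ^ 2)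
    (h : ∀ S' : Finset (Fin d × Fin d), S'.card = S.card →
      SumsDominated (margins (indic S')) (margins (indic S))) : False := by
  have key : ∀ S : Finset (Fin d × Fin d), 4 ≤ S.card → 2 * S.card ≤ d ^ 2 →
      (∀ S' : Finset (Fin d × Fin d), S'.card = S.card →
        SumsDominated (margins (indic S')) (margins (indic S))) → False := by
    intro S h4 h2 h
    rcases le_total S.card d with hle | hle
    · exact not_forall_sumsDominated_of_card_le h4 hle h
    · exact not_forall_sumsDominated_of_le_card hd hle h2 h
  have hcompl : ∀ S : Finset (Fin d × Fin d), Sᶜ.card + S.card = d ^ 2 := fun S => by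
    rw [Finset.card_compl_add_card, Fintype.card_prod, Fintype.card_fin, sq]
  rcases le_total (2 * S.card) (d ^ 2) with h2 | h2
  · exact key S h4 h2 h
  · have hSc := hcompl S
    refine key Sᶜ (by omega) (by omega) fun S' hS' => ?_
    have hc := hcompl S'
    have := sumsDominated_indic_compl (S := S) (S' := S'ᶜ) (by omega) (h S'ᶜ (by omega))
    rwa [compl_compl] at this

/-! ### Dominating tables for extreme ranks -/

/-- For `r ≤ 3` or `r ≥ d² - 3` some table of `r` ones dominates all tables with entries in
`[0, 1]` and total `r`. -/
theorem exists_dominating (hd : 3 ≤ d) {r : ℕ} (hrd : r ≤ d ^ 2) (hr : r ≤ 3 ∨ d ^ 2 - 3 ≤ r) :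
    ∃ S : Finset (Fin d × Fin d), S.card = r ∧ ∀ z : Fin d × Fin d → ℝ,
      (∀ p, 0 ≤ z p) → (∀ p, z p ≤ 1) → ∑ p, z p = r →
        SumsDominated (margins z) (margins (indic S)) := by
  have row : ∀ r ≤ 3, ∃ S : Finset (Fin d × Fin d), S.card = r ∧ ∀ z : Fin d × Fin d → ℝ,
      (∀ p, 0 ≤ z p) → (∀ p, z p ≤ 1) → ∑ p, z p = r →
        SumsDominated (margins z) (margins (indic S)) := by
    intro r hr
    let S : Finset (Fin d × Fin d) := Finset.univ.filter fun p => p.1.val = 0 ∧ p.2.val < r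
    have hS : S.card = r := by
      have : S = {(⟨0, by omega⟩ : Fin d)} ×ˢ Finset.univ.filter fun s : Fin d => s.val < r := by
        ext p
        rw [Finset.mem_product, Finset.mem_singleton, Fin.ext_iff]
        simp [S]
      rw [this, Finset.card_product, Finset.card_singleton, one_mul,
        card_filter_val_lt (by omega)]
    exact ⟨S, hS, fun z h0 h1 hz => sumsDominated_of_row hd hr (by simp [S]) hS h0 h1 hz⟩
  rcases hr with hr | hr
  · exact row r hr
  · obtain ⟨S, hS, h⟩ := row (d ^ 2 - r) (by omega)
    have hc := Finset.card_compl_add_card S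
    rw [Fintype.card_prod, Fintype.card_fin, ← sq] at hc
    refine ⟨Sᶜ, by omega, fun z h0 h1 hz => ?_⟩
    have hz' : ∑ p, (1 - z p) = (d ^ 2 - r : ℕ) := by
      rw [Finset.sum_sub_distrib, hz]
      rw [Nat.cast_sub hrd]
      simp [sq]
    have hdom := (h (fun p => 1 - z p) (fun p => by linarith [h1 p]) (fun p => by linarith [h0 p])
      hz').const_sub (by rw [sum_margins, sum_margins, hz', sum_indic, hS]) d
    rw [← margins_one_sub, ← margins_one_sub, ← indic_compl] at hdom
    simpa using hdom

end Tables

/-! ### From tables back to operators -/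

/-- Unitary diagonalization of a matrix whose spectrum is `lam`, with multiplicity `r`, and `0`. -/
theorem exists_eq_conj_diagonal_indic {d r : ℕ} {lam : ℝ}
    {C : Matrix (Fin d × Fin d) (Fin d × Fin d) ℂ} (hC : C.IsHermitian) (hr : r ≤ d * d)
    (hspec : spec hC = fun k : Fin (d * d) => if k.val < r then lam else 0) :
    ∃ V ∈ Matrix.unitaryGroup (Fin d × Fin d) ℂ, ∃ S : Finset (Fin d × Fin d), S.card = r ∧
      Vᴴ * C * V = Matrix.diagonal fun p => ((lam * indic S p : ℝ) : ℂ) := by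
  obtain ⟨e, he⟩ := exists_eigs_eq hC (N := d * d) (by simp)
  obtain ⟨V, hV, hd⟩ := exists_unitary_diagonal_eigenvalues hC
  refine ⟨V, hV, Finset.univ.filter fun p => (e p).val < r, ?_, ?_⟩
  · exact (Finset.card_bijective e e.bijective (by simp)).trans (card_filter_val_lt hr)
  · rw [hd]
    congr 1
    funext p
    have h := congrFun hspec (e p)
    rw [spec, ← he] at h
    simp [h, indic]

theorem permDiag_eq {d r : ℕ} {lam : ℝ}
    {C : Matrix (Fin d × Fin d) (Fin d × Fin d) ℂ} (hC : C.IsHermitian)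
    (hspec : spec hC = fun k : Fin (d * d) => if k.val < r then lam else 0)
    (π : Equiv.Perm (Fin (d * d))) {S : Finset (Fin d × Fin d)}
    (hS : ∀ p, p ∈ S ↔ (π (finProdFinEquiv p)).val < r) :
    permDiag hC π = Matrix.diagonal fun p => ((lam * indic S p : ℝ) : ℂ) := by
  rw [permDiag, hspec]
  congr 1
  funext p
  simp [indic, hS]

theorem sumsDominated_const_mul_iff {n : ℕ} {x y : Fin n → ℝ} {c : ℝ} (hc : 0 < c) :
    SumsDominated (fun i => c * x i) (fun i => c * y i) ↔ SumsDominated x y := by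
  refine ⟨fun h => ?_, fun h => h.const_mul hc.le⟩
  simpa [inv_mul_cancel_left₀ hc.ne'] using h.const_mul (inv_nonneg.2 hc.le)

theorem exists_permutation_iff {d r : ℕ} (hd : 24 ≤ d) {lam : ℝ} (hlam : 0 < lam)
    {C : Matrix (Fin d × Fin d) (Fin d × Fin d) ℂ} (hC : C.IsHermitian) (hr : r ≤ d * d)
    (hspec : spec hC = fun k : Fin (d * d) => if k.val < r then lam else 0) :
    (∃ π : Equiv.Perm (Fin (d * d)),
      ∀ U : Matrix (Fin d × Fin d) (Fin d × Fin d) ℂ,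
        U ∈ Matrix.unitaryGroup (Fin d × Fin d) ℂ →
          MajorizedBy
            (jointSpec (C := U * C * Uᴴ) (Matrix.isHermitian_mul_mul_conjTranspose U hC))
            (jointSpec (C := permDiag hC π) (isHermitian_permDiag hC π))) ↔
    (r ≤ 3 ∨ d ^ 2 - 3 ≤ r) := by
  obtain ⟨V, hV, S₀, hS₀, hVC⟩ := exists_eq_conj_diagonal_indic hC hr hspec
  constructor
  · rintro ⟨π, h⟩
    by_contra! hcon
    let S : Finset (Fin d × Fin d) := Finset.univ.filter fun p => (π (finProdFinEquiv p)).val < r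
    have hS : S.card = r := by
      exact (Finset.card_bijective (finProdFinEquiv.trans π) (Equiv.bijective _)
        (by simp [S])).trans (card_filter_val_lt hr)
    refine not_forall_sumsDominated (S := S) hd (by omega) (by omega) fun S' hS' => ?_
    -- Reordering the eigenbasis moves the support of the diagonal from `S₀` to the test set `S'`.
    obtain ⟨σ, hσ⟩ := exists_perm_mem_iff (show S'.card = S₀.card by omega)
    have hU := submatrix_mem_unitaryGroup hV σ
    have hmaj := h _ (Unitary.star_mem hU)
    have hX : star (V.submatrix id σ) * C * (star (V.submatrix id σ))ᴴ =
        Matrix.diagonal fun p => ((lam * indic S' p : ℝ) : ℂ) := by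
      rw [Matrix.star_eq_conjTranspose, Matrix.conjTranspose_conjTranspose, conj_submatrix, hVC,
        Matrix.submatrix_diagonal_equiv]
      congr 1
      funext p
      simp [indic, hσ]
    obtain ⟨τ, hτ⟩ := exists_perm_jointSpec_diagonal
      (Matrix.isHermitian_mul_mul_conjTranspose (star (V.submatrix id σ)) hC) hX
    obtain ⟨ρ, hρ⟩ := exists_perm_jointSpec_diagonal (isHermitian_permDiag hC π)
      (permDiag_eq hC hspec π (S := S) (by simp [S]))
    rw [majorizedBy_iff, hτ, hρ, sumsDominated_comp_perm_iff, margins_const_mul,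
      margins_const_mul, sumsDominated_const_mul_iff hlam] at hmaj
    exact hmaj.1
  · intro hr3
    obtain ⟨S, hS, hdom⟩ := exists_dominating (by omega) (by rwa [sq]) hr3
    obtain ⟨π, hπ⟩ := exists_perm_mem_iff
      (S := Finset.univ.filter fun k : Fin (d * d) => k.val < r)
      (S' := S.map finProdFinEquiv.toEmbedding) (by rw [Finset.card_map, hS, card_filter_val_lt hr])
    refine ⟨π, fun U hU => ?_⟩
    obtain ⟨ρ, hρ⟩ := exists_perm_jointSpec_diagonal (isHermitian_permDiag hC π)
      (permDiag_eq hC hspec π (S := S) fun p => by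
        have := hπ (finProdFinEquiv p)
        simp only [Finset.mem_filter, Finset.mem_univ, true_and, Finset.mem_map_equiv,
          Equiv.symm_apply_apply] at this
        exact this.symm)
    obtain ⟨W, hW, hWX⟩ := exists_jointSpec_eq_margins
      (Matrix.isHermitian_mul_mul_conjTranspose U hC)
    have hZ : Wᴴ * U * V ∈ Matrix.unitaryGroup (Fin d × Fin d) ℂ :=
      mul_mem (mul_mem (Unitary.star_mem hW) hU) hV
    obtain ⟨z, h0, h1, hz, hzd⟩ := exists_fractional_diag hZ lam S₀
    have hVV : V * Vᴴ = 1 := Matrix.mem_unitaryGroup_iff.1 hV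
    -- `W` diagonalizes the partial traces of `U * C * Uᴴ` and `V` diagonalizes `C`, so its diagonal
    -- in the basis `W` is that of a conjugate of `lam` times a coordinate projection.
    have hconj : Wᴴ * (U * C * Uᴴ) * W =
        Wᴴ * U * V * (Vᴴ * C * V) * (Wᴴ * U * V)ᴴ := by
      simp only [Matrix.conjTranspose_mul, Matrix.conjTranspose_conjTranspose, Matrix.mul_assoc]
      rw [← Matrix.mul_assoc V Vᴴ, ← Matrix.mul_assoc V Vᴴ, hVV, Matrix.one_mul, Matrix.one_mul]
    rw [← hVC, ← hconj] at hzd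
    simp only [hzd] at hWX
    rw [hS₀] at hz
    rw [majorizedBy_iff, hWX, hρ, margins_const_mul, margins_const_mul]
    refine ⟨((hdom z h0 h1 hz).const_mul hlam.le).comp_perm 1 ρ, ?_⟩
    simp only [Function.comp_apply]
    rw [Equiv.sum_comp ρ fun i => lam * margins (indic S) i, ← Finset.mul_sum, ← Finset.mul_sum,
      sum_margins, sum_margins, hz, sum_indic, hS]

end BipartiteSpectra

theorem mainTheorem7 (d : ℕ) (hd : 24 ≤ d)
    (C : Matrix (Fin d × Fin d) (Fin d × Fin d) ℂ) (hC : C.PosSemidef)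
    (r : ℕ) (hr : C.rank = r) (lam : ℝ)
    (hspec : BipartiteSpectra.spec hC.isHermitian =
      fun k : Fin (d * d) => if k.val < r then lam else 0) :
    (∃ π : Equiv.Perm (Fin (d * d)),
      ∀ U : Matrix (Fin d × Fin d) (Fin d × Fin d) ℂ,
        U ∈ Matrix.unitaryGroup (Fin d × Fin d) ℂ →
          BipartiteSpectra.MajorizedBy
            (BipartiteSpectra.jointSpec (C := U * C * Uᴴ)
              (Matrix.isHermitian_mul_mul_conjTranspose U hC.isHermitian))
            (BipartiteSpectra.jointSpec (C := BipartiteSpectra.permDiag hC.isHermitian π)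
              (BipartiteSpectra.isHermitian_permDiag hC.isHermitian π))) ↔
    (r ≤ 3 ∨ d ^ 2 - 3 ≤ r) := by
  have hrd : r ≤ d * d := by
    rw [← hr]
    simpa using C.rank_le_card_width
  rcases Nat.eq_zero_or_pos r with h0 | hpos
  -- For `r = 0` the value `lam` is arbitrary and never occurs in the spectrum, so it may be
  -- replaced by 1.
  · refine BipartiteSpectra.exists_permutation_iff hd one_pos hC.isHermitian hrd ?_
    rw [hspec, h0]
    simp
  · refine BipartiteSpectra.exists_permutation_iff hd ?_ hC.isHermitian hrd hspec
    obtain ⟨e, he⟩ := BipartiteSpectra.exists_eigs_eq hC.isHermitian (N := d * d) (by simp)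
    have hval : ∀ p, hC.isHermitian.eigenvalues p = if (e p).val < r then lam else 0 :=
      fun p => (he p).trans (congrFun hspec (e p))
    have hnn : 0 ≤ lam := by
      have h1 := hC.eigenvalues_nonneg (e.symm ⟨0, by omega⟩)
      rw [hval] at h1
      simpa [hpos] using h1
    -- If `lam = 0`, all eigenvalues vanish and the rank would be 0.
    refine lt_of_le_of_ne hnn fun hl => ?_
    have hrank := hC.isHermitian.rank_eq_card_non_zero_eigs
    simp only [hval, ← hl, ite_self, ne_eq, not_true_eq_false, Fintype.card_eq_zero] at hrank
    omega
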